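/- For a finite graph $G$ on $n\ge 2$ vertices let $\lambda_1\ge\lambda_2\ge\dots\ge\lambda_n$ be the eigenvalues of its adjacency matrix and put $\lambda(G)=\max\{\lambda_2,|\lambda_n|\}$. An $(n,d,\lambda)$-graph is a $d$-regular graph on $n$ vertices with $|\lambda(G)|\le\lambda$. For graphs $\Gamma$ and $H$, let $\mathrm{ex}(\Gamma,H)$ be the maximum number of edges of a subgraph of $\Gamma$ that contains no copy of $H$ as a (not necessarily induced) subgraph. Let $C_\ell$ denote the cycle of length $\ell$. **Theorem.** Let $k\ge 1$ be an integer, and let $(n_i)$, $(d_i)$ be sequences of integers and $(\lambda_i)$ a sequence of reals, indexed by $i\in\mathbb N$, such that $n_i\ge 0$ and $d_i\ge 1$ for all $i$, $n_i\to\infty$, and $$\frac{\lambda_i^{2k-1}}{\dfrac{d_i^{2k}}{n_i}\,(\log n_i)^{-2(k-1)(2k-1)}}\longrightarrow 0\qquad(i\to\infty).$$ Then $$\mathrm{ex}(\Gamma,C_{2k+1})=\Bigl(\frac12+o(1)\Bigr)\frac{d_i n_i}{2}$$ for $(n_i,d_i,\lambda_i)$-graphs $\Gamma$ as $i\to\infty$,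 uniformly in $\Gamma$; that is, for every $\varepsilon>0$ there is an $i_0$ such that for all $i\ge i_0$ every $(n_i,d_i,\lambda_i)$-graph $\Gamma$ satisfies $$\Bigl|\mathrm{ex}(\Gamma,C_{2k+1})-\frac12\cdot\frac{d_i n_i}{2}\Bigr|\le\varepsilon\,\frac{d_i n_i}{2}.$$ -/

import Mathlib

open Filter Topology

universe u

/-- The real adjacency matrix of a simple graph. -/
noncomputable def realAdjMatrix {V : Type*} (G : SimpleGraph V) : Matrix V V ℝ :=
  open Classical in G.adjMatrix ℝ

theorem realAdjMatrix_isHermitian {V : Type*} (G : SimpleGraph V) :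
    (realAdjMatrix G).IsHermitian := by
  classical
  unfold realAdjMatrix
  ext i j
  simp [Matrix.conjTranspose_apply, SimpleGraph.adjMatrix_apply, SimpleGraph.adj_comm]

/-- The eigenvalues `λ₁ ≥ λ₂ ≥ … ≥ λₙ` of the adjacency matrix, listed with multiplicity in
decreasing order; the index is shifted by one, so `λ₁` is the value at `0`. -/
noncomputable def graphEigenvalue {V : Type*} [Fintype V] (G : SimpleGraph V) :
    Fin (Fintype.card V) → ℝ :=
  open Classical in (realAdjMatrix_isHermitian G).eigenvalues₀

theorem graphEigenvalue_antitone {V : Type*} [Fintype V] (G : SimpleGraph V) :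
    Antitone (graphEigenvalue G) := by
  classical
  exact (realAdjMatrix_isHermitian G).eigenvalues₀_antitone

/-- The second eigenvalue `λ(G) = max {λ₂, |λₙ|}` of a graph on `n ≥ 2` vertices
(set to `0` if `n ≤ 1`, where `λ₂` does not exist). -/
noncomputable def secondEigenvalue {V : Type*} [Fintype V] (G : SimpleGraph V) : ℝ :=
  if h : 2 ≤ Fintype.card V then
    max (graphEigenvalue G ⟨1, by omega⟩) |graphEigenvalue G ⟨Fintype.card V - 1, by omega⟩|
  else 0

/-- `G` is an `(n, d, lam)`-graph: a `d`-regular graph on `n` vertices with `|λ(G)| ≤ lam`. -/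
structure IsNDLambdaGraph {V : Type*} [Fintype V] (G : SimpleGraph V)
    (n d : ℕ) (lam : ℝ) : Prop where
  card_eq : Fintype.card V = n
  regular : ∀ v : V, (G.neighborSet v).ncard = d
  abs_second_le : |secondEigenvalue G| ≤ lam

/-- The generalized Turán number `ex(Γ, H)`: the maximum number of edges of a subgraph of `Γ`
that contains no copy of `H` as a (not necessarily induced) subgraph. -/
noncomputable def generalizedTuranNumber {V W : Type*} (Γ : SimpleGraph V)
    (H : SimpleGraph W) : ℕ :=
  sSup {m : ℕ | ∃ G : SimpleGraph V, G ≤ Γ ∧ H.Free G ∧ G.edgeSet.ncard = m}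

/-- For a finite host graph and a forbidden graph with at least one edge, the supremum in
`generalizedTuranNumber` is attained. -/
theorem isGreatest_generalizedTuranNumber {V W : Type*} [Finite V] (Γ : SimpleGraph V)
    (H : SimpleGraph W) (hH : H ≠ ⊥) :
    IsGreatest {m : ℕ | ∃ G : SimpleGraph V, G ≤ Γ ∧ H.Free G ∧ G.edgeSet.ncard = m}
      (generalizedTuranNumber Γ H) := by
  have hne : {m : ℕ | ∃ G : SimpleGraph V, G ≤ Γ ∧ H.Free G ∧ G.edgeSet.ncard = m}.Nonempty := by
    refine ⟨_, ⊥, bot_le, ?_, rfl⟩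
    rintro ⟨f⟩
    apply hH
    ext a b
    simp only [SimpleGraph.bot_adj, iff_false]
    intro hab
    exact f.toHom.map_adj hab
  have hbdd : BddAbove {m : ℕ | ∃ G : SimpleGraph V, G ≤ Γ ∧ H.Free G ∧ G.edgeSet.ncard = m} := by
    refine ⟨Γ.edgeSet.ncard, ?_⟩
    rintro m ⟨G, hG, -, rfl⟩
    exact Set.ncard_le_ncard (SimpleGraph.edgeSet_mono hG) (Set.toFinite _)
  exact ⟨Nat.sSup_mem hne hbdd, fun m hm => le_csSup hbdd hm⟩

/-! The lower bound is the bipartite half of `Γ`: a random 2-colouring keeps half the edges on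
average, and no odd cycle survives.

For the upper bound let `A`, `M` be the adjacency matrices of `Γ` and of a `C_{2k+1}`-free `G ≤ Γ`,
and let `W_m` count the walks of length `m` in `G`. Since `A - M` and `M` are nonnegative, `tr
(M^(2k) (A - M)) ≤ tr (M^(2k-1) (A - M) A)`. Add `tr M^(2k+1)` to both sides and replace the single
factor `A` by its mean `(d/n) J` (`walk_deficit_le`): `(d/n) (2 W_{2k} - d W_{2k-1}) ≤ tr M^(2k+1) +
error`. If `G` has average degree at least `t = (1/2 + ε) d`, then `W_{2k} ≥ t W_{2k-1}` and `W_{2k}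
≥ t^(2k) n` (`walk_moment_bounds`), so the left side is at least a constant times `ε d^(2k+1)`. The
right side is `O(η d^(2k+1))`, where `η` measures pseudorandomness: the error is the operator norm
of `A - (d/n) J` times `tr A^(2k)`, and every closed walk counted by `tr M^(2k+1)` revisits a vertex
(`SimpleGraph.trace_pow_le_of_free`, `degenerate_bound`). For small `η` this is a contradiction. No
logarithmic gain is needed. -/

open Matrix

/-- The all-ones matrix. -/
def allOnes (V : Type*) : Matrix V V ℝ := fun _ _ => 1

theorem transpose_allOnes {V : Type*} : (allOnes V)ᵀ = allOnes V := rfl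

/-! ### Operator norm bounds and powers of a matrix with constant row sums. -/

section MatrixBounds

variable {V : Type*} [Fintype V]

/-- A bound on the operator norm of a real matrix, in terms of the dot product. -/
def OpBound (E : Matrix V V ℝ) (c : ℝ) : Prop :=
  ∀ x : V → ℝ, (E *ᵥ x) ⬝ᵥ (E *ᵥ x) ≤ c ^ 2 * (x ⬝ᵥ x)

theorem OpBound.pow [DecidableEq V] {E : Matrix V V ℝ} {c : ℝ} (h : OpBound E c) (m : ℕ) :
    OpBound (E ^ m) (c ^ m) := by
  induction m with
  | zero => intro x; simp
  | succ m ih =>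
    intro x
    rw [pow_succ', ← Matrix.mulVec_mulVec]
    calc _ ≤ c ^ 2 * ((E ^ m *ᵥ x) ⬝ᵥ (E ^ m *ᵥ x)) := h _
      _ ≤ c ^ 2 * ((c ^ m) ^ 2 * (x ⬝ᵥ x)) := by gcongr; exact ih x
      _ = _ := by ring

theorem OpBound.abs_dotProduct_le {E : Matrix V V ℝ} {c : ℝ} (h : OpBound E c) (hc : 0 ≤ c)
    (x y : V → ℝ) : |x ⬝ᵥ (E *ᵥ y)| ≤ c * ((x ⬝ᵥ x + y ⬝ᵥ y) / 2) := by
  have hCS : (x ⬝ᵥ (E *ᵥ y)) ^ 2 ≤ (x ⬝ᵥ x) * ((E *ᵥ y) ⬝ᵥ (E *ᵥ y)) := by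
    have := Finset.sum_mul_sq_le_sq_mul_sq Finset.univ x (E *ᵥ y)
    simpa [dotProduct, sq] using this
  have hx : 0 ≤ x ⬝ᵥ x := by simpa using dotProduct_star_self_nonneg x
  have hy : 0 ≤ y ⬝ᵥ y := by simpa using dotProduct_star_self_nonneg y
  apply abs_le_of_sq_le_sq _ (by positivity)
  calc _ ≤ (x ⬝ᵥ x) * (c ^ 2 * (y ⬝ᵥ y)) := hCS.trans (by gcongr; exact h y)
    _ ≤ _ := by nlinarith [mul_nonneg (sq_nonneg c) (sq_nonneg (x ⬝ᵥ x - y ⬝ᵥ y))]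

/-- Summing the bilinear bound over columns: the operator norm of `E` is paired with the
Hilbert–Schmidt norms of `X` and `Y`, which are monotone in nonnegative entries. -/
theorem OpBound.abs_trace_le {E X Y : Matrix V V ℝ} {c s : ℝ} (h : OpBound E c) (hc : 0 ≤ c)
    (hX : (Xᵀ * X).trace ≤ s) (hY : (Yᵀ * Y).trace ≤ s) :
    |(Xᵀ * (E * Y)).trace| ≤ c * s := by
  have key : ∀ Z W : Matrix V V ℝ, (Zᵀ * W).trace = ∑ j, Z.col j ⬝ᵥ W.col j := fun Z W => rfl
  rw [key] at hX hY ⊢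
  calc _ ≤ ∑ j, |X.col j ⬝ᵥ (E * Y).col j| := Finset.abs_sum_le_sum_abs _ _
    _ ≤ ∑ j, c * ((X.col j ⬝ᵥ X.col j + Y.col j ⬝ᵥ Y.col j) / 2) :=
      Finset.sum_le_sum fun j _ => h.abs_dotProduct_le hc _ _
    _ = c * ((∑ j, X.col j ⬝ᵥ X.col j + ∑ j, Y.col j ⬝ᵥ Y.col j) / 2) := by
      rw [← Finset.mul_sum, ← Finset.sum_div, Finset.sum_add_distrib]
    _ ≤ _ := by gcongr; linarith

theorem mul_apply_nonneg_le {X X' Y Y' : Matrix V V ℝ} (hX : ∀ i j, 0 ≤ X i j ∧ X i j ≤ X' i j)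
    (hY : ∀ i j, 0 ≤ Y i j ∧ Y i j ≤ Y' i j) (i j : V) :
    0 ≤ (X * Y) i j ∧ (X * Y) i j ≤ (X' * Y') i j := by
  simp only [Matrix.mul_apply]
  exact ⟨Finset.sum_nonneg fun l _ => mul_nonneg (hX _ _).1 (hY _ _).1,
    Finset.sum_le_sum fun l _ => mul_le_mul (hX _ _).2 (hY _ _).2 (hY _ _).1
      ((hX _ _).1.trans (hX _ _).2)⟩

theorem pow_apply_nonneg_le [DecidableEq V] {X Y : Matrix V V ℝ}
    (h : ∀ i j, 0 ≤ X i j ∧ X i j ≤ Y i j) (m : ℕ) (i j : V) :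
    0 ≤ (X ^ m) i j ∧ (X ^ m) i j ≤ (Y ^ m) i j := by
  induction m generalizing i j with
  | zero => simp only [pow_zero, le_refl, and_true, Matrix.one_apply]; split_ifs <;> norm_num
  | succ m ih => rw [pow_succ, pow_succ]; exact mul_apply_nonneg_le ih h i j

theorem trace_transpose_mul_self_mono {X Y : Matrix V V ℝ}
    (h : ∀ i j, 0 ≤ X i j ∧ X i j ≤ Y i j) : (Xᵀ * X).trace ≤ (Yᵀ * Y).trace := by
  refine Finset.sum_le_sum fun i _ => ?_
  exact (mul_apply_nonneg_le (X := Xᵀ) (X' := Yᵀ) (fun i j => h j i) h i i).2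

theorem mul_allOnes_apply (X : Matrix V V ℝ) (i j : V) :
    (X * allOnes V) i j = (X *ᵥ 1) i := by
  simp [Matrix.mul_apply, allOnes, mulVec, dotProduct]

theorem trace_mul_allOnes (X : Matrix V V ℝ) : (X * allOnes V).trace = 1 ⬝ᵥ (X *ᵥ 1) := by
  simp only [Matrix.trace, Matrix.diag, mul_allOnes_apply, dotProduct, Pi.one_apply, one_mul]

/-- A symmetric matrix with all row sums equal to `D`, minus its mean. -/
noncomputable def centered (A : Matrix V V ℝ) (D : ℝ) : Matrix V V ℝ :=
  A - (D / Fintype.card V) • allOnes V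

variable {A : Matrix V V ℝ} {D : ℝ}

theorem centered_isSymm (hA : A.IsSymm) : (centered A D).IsSymm := by
  unfold centered Matrix.IsSymm
  rw [transpose_sub, transpose_smul, transpose_allOnes, hA.eq]

theorem centered_mul_allOnes [Nonempty V] (hD : A *ᵥ 1 = D • 1) :
    centered A D * allOnes V = 0 := by
  ext i j
  rw [mul_allOnes_apply, centered, sub_mulVec, hD, smul_mulVec]
  have : (Fintype.card V : ℝ) ≠ 0 := by simp
  simp [mulVec, dotProduct, allOnes, this]

/-- The centered part annihilates the all-ones matrix, so no cross terms appear. The exponent must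
be positive, since the zeroth power is the identity. -/
theorem pow_eq_centered_pow_add [DecidableEq V] [Nonempty V] (hA : A.IsSymm)
    (hD : A *ᵥ 1 = D • 1) (m : ℕ) :
    A ^ (m + 1) = centered A D ^ (m + 1) + (D ^ (m + 1) / Fintype.card V) • allOnes V := by
  have hN : (Fintype.card V : ℝ) ≠ 0 := by simp
  have hAE : A = centered A D + (D / Fintype.card V) • allOnes V := by simp [centered]
  induction m with
  | zero => simpa using hAE
  | succ m ih =>
    have hJA : allOnes V * A = D • allOnes V := by
      have : A * allOnes V = D • allOnes V := by
        ext i j; rw [mul_allOnes_apply, hD]; simp [allOnes]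
      have := congrArg Matrix.transpose this
      rwa [transpose_mul, transpose_allOnes, hA.eq, transpose_smul, transpose_allOnes] at this
    have hEA : centered A D ^ (m + 1) * A = centered A D ^ (m + 2) := by
      rw [congrArg (centered A D ^ (m + 1) * ·) hAE]
      rw [mul_add, ← pow_succ, mul_smul_comm, pow_succ _ m, mul_assoc (centered A D ^ m),
        centered_mul_allOnes hD, mul_zero, smul_zero, add_zero]
    rw [pow_succ, ih, add_mul, hEA, smul_mul_assoc, hJA, smul_smul]
    congr 2
    ring

theorem centered_sq_diag [DecidableEq V] [Nonempty V] (hA : A.IsSymm) (hD : A *ᵥ 1 = D • 1)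
    {v : V} (hv : (A ^ 2) v v = D) :
    (centered A D *ᵥ Pi.single v 1) ⬝ᵥ (centered A D *ᵥ Pi.single v 1) =
      D - D ^ 2 / Fintype.card V := by
  have h := congrFun (congrFun (pow_eq_centered_pow_add hA hD 1) v) v
  rw [show 1 + 1 = 2 from rfl, hv] at h
  have h2 : (centered A D ^ 2) v v = ∑ j, centered A D j v * centered A D j v := by
    rw [sq, Matrix.mul_apply]
    exact Finset.sum_congr rfl fun j _ => by rw [(centered_isSymm hA).apply]
  simp only [Matrix.mulVec_single_one, dotProduct, Matrix.col_apply]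
  rw [← h2]
  simp [allOnes] at h
  linarith

/-- Testing the norm on a basis vector: unless the graph is dense, `c` is at least of order `√D`. -/
theorem le_opBound_sq [DecidableEq V] [Nonempty V] (hA : A.IsSymm) (hD : A *ᵥ 1 = D • 1)
    {v : V} (hv : (A ^ 2) v v = D) {c : ℝ} (hE : OpBound (centered A D) c) :
    D - D ^ 2 / Fintype.card V ≤ c ^ 2 := by
  rw [← centered_sq_diag hA hD hv]
  simpa using hE (Pi.single v 1)

/-- With `x = E e_v`, the diagonal entry of `E ^ a` is `x ⬝ᵥ E ^ (a - 2) x`, and the squared norm of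
`x` is at most `D`. -/
theorem pow_diag_le [DecidableEq V] [Nonempty V] (hA : A.IsSymm) (hD : A *ᵥ 1 = D • 1)
    {v : V} (hv : (A ^ 2) v v = D) {c : ℝ} (hc : 0 ≤ c) (hE : OpBound (centered A D) c)
    (a : ℕ) (ha : 2 ≤ a) :
    (A ^ a) v v ≤ D ^ a / Fintype.card V + c ^ (a - 2) * D := by
  obtain ⟨m, rfl⟩ := Nat.exists_eq_add_of_le' ha
  rw [pow_eq_centered_pow_add hA hD (m + 1)]
  have hs := centered_sq_diag hA hD hv
  set E := centered A D
  set x := E *ᵥ Pi.single v 1 with hx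
  have hEs : Eᵀ = E := (centered_isSymm hA).eq
  have h1 : (E ^ (m + 1 + 1)) v v = x ⬝ᵥ (E ^ m *ᵥ x) := by
    rw [hx, mulVec_mulVec, ← pow_succ, ← hEs, mulVec_transpose, ← dotProduct_mulVec, hEs,
      mulVec_mulVec, ← pow_succ']
    simp
  have h2 := (hE.pow m).abs_dotProduct_le (by positivity) x x
  rw [hs] at h2
  have h3 : (0:ℝ) ≤ D ^ 2 / Fintype.card V := by positivity
  have h4 : x ⬝ᵥ (E ^ m *ᵥ x) ≤ c ^ m * D := by
    refine (le_abs_self _).trans (h2.trans ?_)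
    gcongr; linarith
  simp only [Matrix.add_apply, Matrix.smul_apply, allOnes, smul_eq_mul, mul_one, h1,
    Nat.add_sub_cancel]
  linarith

end MatrixBounds

/-! ### Closed walks with a repeated vertex. -/

namespace SimpleGraph

open Walk

/-- The disjunction excludes the trivial coincidence of the two endpoints of the closed walk. -/
theorem Walk.exists_repeat_of_not_isCycle {V : Type*} {G : SimpleGraph V} {v : V}
    {p : G.Walk v v}
    (h3 : 3 ≤ p.length) (hp : ¬ p.IsCycle) :
    ∃ i j, i < j ∧ j ≤ p.length ∧ (0 < i ∨ j < p.length) ∧ p.getVert i = p.getVert j := by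
  rw [isCycle_iff_isPath_tail_and_le_length] at hp
  have hp' : ¬ p.tail.IsPath := fun h => hp ⟨h, h3⟩
  rw [← IsPath.getVert_injOn_iff] at hp'
  simp only [Set.InjOn, not_forall] at hp'
  obtain ⟨i, hi, j, hj, hij, hne⟩ := hp'
  have hlen : p.tail.length + 1 = p.length :=
    length_tail_add_one (by rw [not_nil_iff_lt_length]; omega)
  simp only [Set.mem_ofPred_eq] at hi hj
  rw [getVert_tail, getVert_tail] at hij
  rcases lt_or_gt_of_ne hne with h | h
  · exact ⟨i + 1, j + 1, by omega, by omega, by omega, hij⟩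
  · exact ⟨j + 1, i + 1, by omega, by omega, by omega, hij.symm⟩

theorem Walk.exists_eq_append {V : Type*} {G : SimpleGraph V} {u v w : V}
    (p : G.Walk u v) {i : ℕ}
    (hi : i ≤ p.length) (hw : p.getVert i = w) :
    ∃ (q : G.Walk u w) (s : G.Walk w v), p = q.append s ∧ q.length = i ∧
      s.length = p.length - i ∧ ∀ j, s.getVert j = p.getVert (i + j) := by
  subst hw
  refine ⟨p.take i, p.drop i, (append_take_drop_eq p i).symm, ?_, drop_length p i,
    drop_getVert p i⟩
  rw [take_length]; omega

theorem Walk.exists_eq_append_append {V : Type*} {G : SimpleGraph V} {u v w : V}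
    (p : G.Walk u v) {i j : ℕ}
    (hij : i ≤ j) (hj : j ≤ p.length) (hi' : p.getVert i = w) (hj' : p.getVert j = w) :
    ∃ (q : G.Walk u w) (r : G.Walk w w) (s : G.Walk w v), p = q.append (r.append s) ∧
      q.length = i ∧ r.length = j - i ∧ s.length = p.length - j := by
  obtain ⟨q, t, hp, hq, ht, hget⟩ := p.exists_eq_append (hij.trans hj) hi'
  obtain ⟨r, s, ht', hr, hs, -⟩ := t.exists_eq_append (i := j - i) (w := w) (by omega)
    (by rw [hget, Nat.add_sub_cancel' hij, hj'])
  exact ⟨q, r, s, by rw [hp, ht'], hq, hr, by omega⟩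

variable {V : Type*} [Fintype V] [DecidableEq V] (G : SimpleGraph V) [DecidableRel G.Adj]

/-- The number of closed walks of length `m` whose positions `i ≤ j` agree. -/
theorem sum_card_walk_repeat_le {m i j : ℕ} (hij : i ≤ j) (hj : j ≤ m) :
    ∑ v, (({p ∈ G.finsetWalkLength m v v | p.getVert i = p.getVert j}.card : ℕ) : ℝ) ≤
      ∑ w, (G.adjMatrix ℝ ^ (j - i)) w w * (G.adjMatrix ℝ ^ (m - (j - i))) w w := by
  have hcard : ∀ l u v, (G.adjMatrix ℝ ^ l) u v = ((G.finsetWalkLength l u v).card : ℝ) := by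
    intro l u v
    rw [adjMatrix_pow_apply_eq_card_walk, card_set_walk_length_eq]
  have hle : ∀ v, (({p ∈ G.finsetWalkLength m v v | p.getVert i = p.getVert j}.card : ℕ) : ℝ) ≤
      ∑ w, (G.adjMatrix ℝ ^ i) v w * ((G.adjMatrix ℝ ^ (j - i)) w w *
        (G.adjMatrix ℝ ^ (m - j)) w v) := by
    intro v
    simp only [hcard, ← Finset.card_product, ← Nat.cast_mul, ← Nat.cast_sum]
    rw [Nat.cast_le, ← Finset.card_sigma]
    refine Finset.card_le_card_of_surjOn
      (fun x => x.2.1.append (x.2.2.1.append x.2.2.2)) ?_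
    intro p hp
    simp only [Finset.coe_filter, mem_finsetWalkLength_iff, Set.mem_ofPred_eq] at hp
    obtain ⟨q, r, s, hqrs, hq, hr, hs⟩ :=
      p.exists_eq_append_append hij (by omega) hp.2 rfl
    refine ⟨⟨p.getVert j, q, r, s⟩, ?_, hqrs.symm⟩
    simp [mem_finsetWalkLength_iff, hq, hr, hs, hp.1]
  calc _ ≤ ∑ v, ∑ w, (G.adjMatrix ℝ ^ i) v w * ((G.adjMatrix ℝ ^ (j - i)) w w *
        (G.adjMatrix ℝ ^ (m - j)) w v) := Finset.sum_le_sum fun v _ => hle v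
    _ = ∑ w, (G.adjMatrix ℝ ^ (j - i)) w w * ∑ v, (G.adjMatrix ℝ ^ (m - j)) w v *
        (G.adjMatrix ℝ ^ i) v w := by
      rw [Finset.sum_comm]
      refine Finset.sum_congr rfl fun w _ => ?_
      rw [Finset.mul_sum]
      exact Finset.sum_congr rfl fun v _ => by ring
    _ = _ := by
      refine Finset.sum_congr rfl fun w _ => ?_
      -- The piece after the repeat followed by the piece before it is one closed walk at `w`.
      rw [← Matrix.mul_apply, ← pow_add, show m - j + i = m - (j - i) by omega]

/-- If `G` has no cycle of length `m`, every closed walk of length `m` visits a vertex twice. -/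
theorem trace_pow_le_of_free {m : ℕ} (hm : 3 ≤ m) (hG : (cycleGraph m).Free G) {q : ℝ}
    (hq : 0 ≤ q) (h : ∀ a b, 2 ≤ a → 2 ≤ b → a + b = m →
      ∑ w, (G.adjMatrix ℝ ^ a) w w * (G.adjMatrix ℝ ^ b) w w ≤ q) :
    (G.adjMatrix ℝ ^ m).trace ≤ (m + 1) ^ 2 * q := by
  classical
  let I : Finset (ℕ × ℕ) := {x ∈ Finset.range (m + 1) ×ˢ Finset.range (m + 1) |
    x.1 < x.2 ∧ (0 < x.1 ∨ x.2 < m)}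
  have hterm : ∀ x ∈ I, ∑ v,
      (({p ∈ G.finsetWalkLength m v v | p.getVert x.1 = p.getVert x.2}.card : ℕ) : ℝ) ≤ q := by
    intro x hx
    simp only [I, Finset.mem_filter, Finset.mem_product, Finset.mem_range] at hx
    refine (G.sum_card_walk_repeat_le hx.2.1.le (by omega : x.2 ≤ m)).trans ?_
    -- A piece of length one would be a loop, so the corresponding diagonal entries vanish.
    by_cases h1 : x.2 - x.1 = 1
    · simpa [h1] using hq
    by_cases h2 : m - (x.2 - x.1) = 1
    · simpa [h2] using hq
    exact h _ _ (by omega) (by omega) (by omega)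
  have hI : (I.card : ℝ) ≤ (m + 1) ^ 2 := by
    have : I.card ≤ (m + 1) ^ 2 := (Finset.card_filter_le _ _).trans (by simp [sq])
    exact_mod_cast this
  have hv : ∀ v, (G.adjMatrix ℝ ^ m) v v ≤
      ∑ x ∈ I, (({p ∈ G.finsetWalkLength m v v | p.getVert x.1 = p.getVert x.2}.card : ℕ) : ℝ) := by
    intro v
    rw [adjMatrix_pow_apply_eq_card_walk, card_set_walk_length_eq, ← Nat.cast_sum, Nat.cast_le]
    refine (Finset.card_le_card ?_).trans Finset.card_biUnion_le
    intro p hp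
    rw [mem_finsetWalkLength_iff] at hp
    have hnc : ¬ p.IsCycle := fun hc =>
      hG ((cycleGraph_isContained_iff (by omega)).2 ⟨v, p, hc, hp⟩)
    obtain ⟨i, j, hij, hj, h0, he⟩ := exists_repeat_of_not_isCycle (by omega) hnc
    simp only [Finset.mem_biUnion, Finset.mem_filter, mem_finsetWalkLength_iff]
    refine ⟨(i, j), ?_, hp, he⟩
    simp only [I, Finset.mem_filter, Finset.mem_product, Finset.mem_range]
    omega
  calc (G.adjMatrix ℝ ^ m).trace
      ≤ ∑ v, ∑ x ∈ I,
        (({p ∈ G.finsetWalkLength m v v | p.getVert x.1 = p.getVert x.2}.card : ℕ) : ℝ) :=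
        Finset.sum_le_sum fun v _ => hv v
    _ = ∑ x ∈ I, ∑ v,
        (({p ∈ G.finsetWalkLength m v v | p.getVert x.1 = p.getVert x.2}.card : ℕ) : ℝ) :=
        Finset.sum_comm
    _ ≤ ∑ x ∈ I, q := Finset.sum_le_sum hterm
    _ = I.card * q := by simp
    _ ≤ _ := by gcongr

end SimpleGraph

/-! ### Eigenbases, the norm of the centered matrix, and walk moments. -/

theorem dotProduct_mulVec_of_isSymm {V : Type*} [Fintype V] {A : Matrix V V ℝ}
    (hA : A.IsSymm) (x y : V → ℝ) :
    x ⬝ᵥ (A *ᵥ y) = (A *ᵥ x) ⬝ᵥ y := by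
  rw [dotProduct_mulVec, ← mulVec_transpose, hA.eq]

section Spectral

variable {V : Type*} [Fintype V] [DecidableEq V]

theorem Matrix.IsHermitian.exists_eigenbasis {A : Matrix V V ℝ} (hA : A.IsHermitian) :
    ∃ u : V → V → ℝ, (∀ i, A *ᵥ u i = hA.eigenvalues i • u i) ∧
      ∀ x y : V → ℝ, x ⬝ᵥ y = ∑ i, (u i ⬝ᵥ x) * (u i ⬝ᵥ y) := by
  refine ⟨fun i => hA.eigenvectorBasis i, hA.mulVec_eigenvectorBasis, fun x y => ?_⟩
  have h := hA.eigenvectorBasis.sum_inner_mul_inner (WithLp.toLp 2 x) (WithLp.toLp 2 y)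
  simp only [EuclideanSpace.inner_eq_star_dotProduct, star_trivial] at h
  rw [dotProduct_comm x y, ← h]
  exact Finset.sum_congr rfl fun i _ => by rw [dotProduct_comm y]

/-- As `c < D`, every eigenvector other than `u i₀` has eigenvalue different from `D`, hence is
orthogonal to `1`. Thus `u i₀` is parallel to `1` and is killed by centering, while the others keep
their eigenvalues. -/
theorem opBound_centered [Nonempty V] {A : Matrix V V ℝ} (hA : A.IsHermitian) {D c : ℝ}
    (hD : A *ᵥ 1 = D • 1) (hcD : c < D) {i₀ : V}
    (hi₀ : ∀ i ≠ i₀, |hA.eigenvalues i| ≤ c) : OpBound (centered A D) c := by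
  have hs : A.IsSymm := by simpa [Matrix.IsHermitian, Matrix.IsSymm] using hA
  obtain ⟨u, hu, hP⟩ := hA.exists_eigenbasis
  have hort : ∀ i ≠ i₀, u i ⬝ᵥ 1 = 0 := by
    intro i hi
    have h1 := dotProduct_mulVec_of_isSymm hs (u i) 1
    rw [hD, hu, dotProduct_smul, smul_dotProduct, smul_eq_mul, smul_eq_mul] at h1
    have h2 : hA.eigenvalues i ≠ D := by
      have := (le_abs_self _).trans (hi₀ i hi)
      linarith
    have h3 : (D - hA.eigenvalues i) * (u i ⬝ᵥ 1) = 0 := by linarith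
    exact (mul_eq_zero.1 h3).resolve_left (sub_ne_zero.2 h2.symm)
  have hone : ∀ y, (1 : V → ℝ) ⬝ᵥ y = (u i₀ ⬝ᵥ 1) * (u i₀ ⬝ᵥ y) := by
    intro y
    rw [hP, Finset.sum_eq_single i₀ (fun i _ hi => by rw [hort i hi, zero_mul]) (by simp)]
  have hne : u i₀ ⬝ᵥ 1 ≠ 0 := by
    intro h
    have := hone 1
    rw [h, zero_mul] at this
    simp [dotProduct] at this
  have hes := centered_isSymm (D := D) hs
  have hE1 : centered A D *ᵥ 1 = 0 := by
    ext i
    have := congrFun (congrFun (centered_mul_allOnes hD) i) i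
    rwa [mul_allOnes_apply] at this
  intro x
  rw [hP, hP x, Finset.mul_sum]
  refine Finset.sum_le_sum fun i _ => ?_
  by_cases hi : i = i₀
  · have h0 := hone (centered A D *ᵥ x)
    rw [dotProduct_mulVec_of_isSymm hes, hE1, zero_dotProduct] at h0
    have h0' : u i₀ ⬝ᵥ (centered A D *ᵥ x) = 0 := (mul_eq_zero.1 h0.symm).resolve_left hne
    rw [hi, h0', zero_mul]
    exact mul_nonneg (sq_nonneg c) (mul_self_nonneg _)
  · have hEu : centered A D *ᵥ u i = hA.eigenvalues i • u i := by
      rw [centered, sub_mulVec, hu, smul_mulVec]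
      have : allOnes V *ᵥ u i = 0 := by
        ext j
        have := hort i hi
        rw [dotProduct_comm] at this
        exact this
      rw [this, smul_zero, sub_zero]
    rw [dotProduct_mulVec_of_isSymm hes, hEu, smul_dotProduct, smul_eq_mul]
    have h2 : hA.eigenvalues i ^ 2 ≤ c ^ 2 := by
      rw [← sq_abs]
      exact pow_le_pow_left₀ (abs_nonneg _) (hi₀ i hi) 2
    nlinarith [mul_nonneg (sub_nonneg.2 h2) (sq_nonneg (u i ⬝ᵥ x))]

/-- The number of walks of length `m`, as a quadratic form, in terms of the spectral measure. -/
theorem exists_walk_moments {M : Matrix V V ℝ} (hM : M.IsHermitian) :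
    ∃ μ w : V → ℝ, (∀ i, 0 ≤ w i) ∧
      ∀ m : ℕ, (1 : V → ℝ) ⬝ᵥ ((M ^ m) *ᵥ 1) = ∑ i, w i * μ i ^ m := by
  have hs : M.IsSymm := by simpa [Matrix.IsHermitian, Matrix.IsSymm] using hM
  obtain ⟨u, hu, hP⟩ := hM.exists_eigenbasis
  refine ⟨hM.eigenvalues, fun i => (u i ⬝ᵥ 1) ^ 2, fun i => sq_nonneg _, fun m => ?_⟩
  rw [hP]
  refine Finset.sum_congr rfl fun i _ => ?_
  have hpow : (M ^ m) *ᵥ u i = hM.eigenvalues i ^ m • u i := by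
    induction m with
    | zero => simp
    | succ m ih => rw [pow_succ, ← mulVec_mulVec, hu, mulVec_smul, ih, smul_smul, pow_succ']
  rw [dotProduct_mulVec_of_isSymm (hs.pow m), hpow, smul_dotProduct, smul_eq_mul]
  ring

/-- Walk counts are moments of a positive measure with mean at least `t`. The first bound compares
the increasing functions `x` and `x ^ (2k-1)` around `t`; the second uses the tangent at `t` to the
convex `x ^ (2k)`. The parities allow negative eigenvalues. -/
theorem walk_moment_bounds {M : Matrix V V ℝ} (hM : M.IsHermitian) {t : ℝ} (ht : 0 ≤ t)
    (h1 : t * Fintype.card V ≤ 1 ⬝ᵥ (M *ᵥ 1)) {k : ℕ} (hk : 1 ≤ k) :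
    t * (1 ⬝ᵥ ((M ^ (2 * k - 1)) *ᵥ 1)) ≤ 1 ⬝ᵥ ((M ^ (2 * k)) *ᵥ 1) ∧
      t ^ (2 * k) * Fintype.card V ≤ 1 ⬝ᵥ ((M ^ (2 * k)) *ᵥ 1) := by
  obtain ⟨μ, w, hw, hm⟩ := exists_walk_moments hM
  have h0 : ∑ i, w i = Fintype.card V := by
    have := hm 0
    simpa [dotProduct] using this.symm
  have h1' : t * ∑ i, w i ≤ ∑ i, w i * μ i := by
    have := hm 1
    simp only [pow_one] at this
    rwa [h0, ← this]
  obtain ⟨j, rfl⟩ := Nat.exists_eq_add_of_le' hk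
  rw [hm, hm, ← h0, show 2 * (j + 1) - 1 = 2 * j + 1 by omega,
    show 2 * (j + 1) = 2 * j + 2 by ring]
  constructor
  · have key : ∀ i, w i * (t ^ (2 * j + 1) * (μ i - t)) ≤
        w i * (μ i ^ (2 * j + 2) - t * μ i ^ (2 * j + 1)) := by
      intro i
      refine mul_le_mul_of_nonneg_left ?_ (hw i)
      have hmono : StrictMono fun x : ℝ => x ^ (2 * j + 1) := Odd.strictMono_pow ⟨j, rfl⟩
      have : 0 ≤ (μ i - t) * (μ i ^ (2 * j + 1) - t ^ (2 * j + 1)) := by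
        rcases le_total t (μ i) with h | h
        · exact mul_nonneg (sub_nonneg.2 h) (sub_nonneg.2 (hmono.monotone h))
        · exact mul_nonneg_of_nonpos_of_nonpos (sub_nonpos.2 h) (sub_nonpos.2 (hmono.monotone h))
      linear_combination this
    have hsum := Finset.sum_le_sum fun i (_ : i ∈ Finset.univ) => key i
    have hl : ∑ i, w i * (t ^ (2 * j + 1) * (μ i - t)) =
        t ^ (2 * j + 1) * (∑ i, w i * μ i - t * ∑ i, w i) := by
      rw [Finset.mul_sum, ← Finset.sum_sub_distrib, Finset.mul_sum]
      exact Finset.sum_congr rfl fun i _ => by ring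
    have hr : ∑ i, w i * (μ i ^ (2 * j + 2) - t * μ i ^ (2 * j + 1)) =
        ∑ i, w i * μ i ^ (2 * j + 2) - t * ∑ i, w i * μ i ^ (2 * j + 1) := by
      rw [Finset.mul_sum, ← Finset.sum_sub_distrib]
      exact Finset.sum_congr rfl fun i _ => by ring
    have : 0 ≤ t ^ (2 * j + 1) * (∑ i, w i * μ i - t * ∑ i, w i) :=
      mul_nonneg (by positivity) (sub_nonneg.2 h1')
    linarith
  · have key : ∀ i, w i * (t ^ (2 * j + 2) + (2 * j + 2) * t ^ (2 * j + 1) * (μ i - t)) ≤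
        w i * μ i ^ (2 * j + 2) := by
      intro i
      refine mul_le_mul_of_nonneg_left ?_ (hw i)
      have hc : ConvexOn ℝ Set.univ fun x : ℝ => x ^ (2 * j + 2) :=
        Even.convexOn_pow ⟨j + 1, by ring⟩
      have hd : HasDerivAt (fun x : ℝ => x ^ (2 * j + 2)) ((2 * j + 2) * t ^ (2 * j + 1)) t := by
        simpa using hasDerivAt_pow (2 * j + 2) t
      rcases lt_trichotomy t (μ i) with h | h | h
      · have := hc.le_slope_of_hasDerivAt (Set.mem_univ _) (Set.mem_univ _) h hd
        rw [slope_def_field, le_div_iff₀ (by linarith)] at this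
        linarith
      · simp [h]
      · have := hc.slope_le_of_hasDerivAt (Set.mem_univ _) (Set.mem_univ _) h hd
        rw [slope_def_field, div_le_iff₀ (by linarith)] at this
        linarith
    have hsum := Finset.sum_le_sum fun i (_ : i ∈ Finset.univ) => key i
    have hl : ∑ i, w i * (t ^ (2 * j + 2) + (2 * j + 2) * t ^ (2 * j + 1) * (μ i - t)) =
        t ^ (2 * j + 2) * ∑ i, w i +
          (2 * j + 2) * t ^ (2 * j + 1) * (∑ i, w i * μ i - t * ∑ i, w i) := by
      rw [Finset.mul_sum, Finset.mul_sum, ← Finset.sum_sub_distrib, Finset.mul_sum,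
        ← Finset.sum_add_distrib]
      exact Finset.sum_congr rfl fun i _ => by ring
    have : 0 ≤ (2 * j + 2) * t ^ (2 * j + 1) * (∑ i, w i * μ i - t * ∑ i, w i) :=
      mul_nonneg (by positivity) (sub_nonneg.2 h1')
    linarith

end Spectral

/-! ### The trace comparison and the size of its error terms. -/

/-- Comparison of closed walks with `2k` steps in `M` and one step in `A` with walks of `M`. -/
theorem walk_deficit_le {V : Type*} [Fintype V] [DecidableEq V] {A M : Matrix V V ℝ}
    (hM : M.IsSymm) (hMA : ∀ i j, 0 ≤ M i j ∧ M i j ≤ A i j) (hA : A.IsSymm) {D c S : ℝ}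
    (hD : A *ᵥ 1 = D • 1) (hc : 0 ≤ c) (hE : OpBound (centered A D) c) {k : ℕ} (hk : 1 ≤ k)
    (hS : (A ^ (2 * k)).trace ≤ S) :
    D / Fintype.card V * (2 * (1 ⬝ᵥ ((M ^ (2 * k)) *ᵥ 1)) - D * (1 ⬝ᵥ ((M ^ (2 * k - 1)) *ᵥ 1))) ≤
      (M ^ (2 * k + 1)).trace + 2 * (c * S) := by
  obtain ⟨j, rfl⟩ := Nat.exists_eq_add_of_le' hk
  rw [show 2 * (j + 1) - 1 = 2 * j + 1 by omega]
  let δ := D / Fintype.card V 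
  let E := centered A D 
  have hAE : A = E + δ • allOnes V := by simp [E, centered, δ]
  have hB : ∀ i j, 0 ≤ (A - M) i j ∧ (A - M) i j ≤ A i j := fun i j => by
    have := hMA i j
    simp only [Matrix.sub_apply]
    constructor <;> linarith
  have hAS : ((A ^ (j + 1))ᵀ * A ^ (j + 1)).trace ≤ S := by
    rwa [(hA.pow _).eq, ← pow_add, show j + 1 + (j + 1) = 2 * (j + 1) by ring]
  have hY : ((M ^ (j + 1))ᵀ * M ^ (j + 1)).trace ≤ S :=
    (trace_transpose_mul_self_mono (pow_apply_nonneg_le hMA (j + 1))).trans hAS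
  -- The odd word `M^(2j+1) (A - M)` is split cyclically into two halves, each dominated entrywise
  -- by `A ^ (j + 1)`.
  have hX : (((A - M) * M ^ j)ᵀ * ((A - M) * M ^ j)).trace ≤ S := by
    refine (trace_transpose_mul_self_mono (Y := A ^ (j + 1)) ?_).trans hAS
    rw [pow_succ']
    exact mul_apply_nonneg_le hB (pow_apply_nonneg_le hMA j)
  have e1 := hE.abs_trace_le hc hY hY
  have e2 := hE.abs_trace_le hc hX hY
  rw [(hM.pow _).eq, trace_mul_comm, mul_assoc, ← pow_add, trace_mul_comm,
    show j + 1 + (j + 1) = 2 * (j + 1) by ring] at e1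
  rw [transpose_mul, (hM.pow _).eq, (hA.sub hM).eq, trace_mul_comm, mul_assoc, trace_mul_comm,
    mul_assoc, ← mul_assoc (M ^ (j + 1)), ← mul_assoc (M ^ (j + 1)), ← pow_add,
    show j + 1 + j = 2 * j + 1 by ring] at e2
  have t1 : (M ^ (2 * (j + 1)) * A).trace =
      (M ^ (2 * (j + 1)) * E).trace + δ * (1 ⬝ᵥ ((M ^ (2 * (j + 1))) *ᵥ 1)) := by
    rw [congrArg (M ^ (2 * (j + 1)) * ·) hAE]
    rw [mul_add, trace_add, mul_smul_comm, trace_smul, trace_mul_allOnes, smul_eq_mul]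
  have hpow : M ^ (2 * (j + 1)) = M ^ (2 * j + 1) * M := by rw [← pow_succ]; congr 1
  have t2 : (M ^ (2 * j + 1) * (A - M) * A).trace = ((M ^ (2 * j + 1) * (A - M)) * E).trace +
      δ * (D * (1 ⬝ᵥ ((M ^ (2 * j + 1)) *ᵥ 1)) - 1 ⬝ᵥ ((M ^ (2 * (j + 1))) *ᵥ 1)) := by
    rw [congrArg (M ^ (2 * j + 1) * (A - M) * ·) hAE]
    rw [mul_add, trace_add, mul_smul_comm, trace_smul, trace_mul_allOnes, smul_eq_mul,
      ← mulVec_mulVec, sub_mulVec, hD, mulVec_sub, mulVec_smul, dotProduct_sub, dotProduct_smul,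
      smul_eq_mul, mulVec_mulVec, ← hpow]
  have t3 : (M ^ (2 * (j + 1)) * A).trace =
      (M ^ (2 * (j + 1) + 1)).trace + (M ^ (2 * (j + 1)) * (A - M)).trace := by
    rw [mul_sub, trace_sub, pow_succ _ (2 * (j + 1))]
    ring
  -- Cyclicity turns the left side into `tr (M^(2j+1) (A - M) M)`; enlarging the last `M` to `A`
  -- only adds nonnegative terms.
  have t4 : (M ^ (2 * (j + 1)) * (A - M)).trace ≤ (M ^ (2 * j + 1) * (A - M) * A).trace := by
    have h1 : (M ^ (2 * j + 1) * (A - M) * A).trace =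
        (M ^ (2 * j + 1) * (A - M) * M).trace + (M ^ (2 * j + 1) * (A - M) * (A - M)).trace := by
      rw [← trace_add, ← mul_add, add_sub_cancel]
    have h2 : (M ^ (2 * j + 1) * (A - M) * M).trace = (M ^ (2 * (j + 1)) * (A - M)).trace := by
      rw [trace_mul_comm, ← mul_assoc, ← pow_succ']
      rfl
    have h3 : 0 ≤ (M ^ (2 * j + 1) * (A - M) * (A - M)).trace :=
      Finset.sum_nonneg fun i _ => (mul_apply_nonneg_le
        (mul_apply_nonneg_le (pow_apply_nonneg_le hMA _) hB) hB i i).1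
    linarith
  have b1 := (abs_le.1 e1).1
  have b2 := (abs_le.1 e2).2
  linarith

/-- Two closed walks at a common vertex, of lengths `p + 2` and `r + 2`. The four terms of the
product contribute `1 + 2 + 2 + 4 = 9`; sparse and dense cases are separated at `2 * D = N`. -/
theorem degenerate_bound {N D c η : ℝ} {p r : ℕ} (hD : 0 < D) (hDN : D ≤ N) (hc : 0 ≤ c)
    (hη : 0 < η) (hη1 : η ≤ 1) (hcD : c ≤ η * D) (hηN : 1 ≤ η * N)
    (hsq : 2 * D ≤ N → D ≤ 2 * c ^ 2) (hmain : c ^ (p + r + 2) * N ≤ η * D ^ (p + r + 3)) :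
    N * ((D ^ (p + 2) / N + c ^ p * D) * (D ^ (r + 2) / N + c ^ r * D)) ≤
      9 * η * D ^ (p + r + 4) := by
  have hN : 0 < N := hD.trans_le hDN
  have hcD' : c ≤ D := hcD.trans (by nlinarith)
  have hηD : 1 ≤ 2 * (η * D) := by
    rcases le_or_gt (2 * D) N with h | h
    · have h1 := hsq h
      have h2 : c ^ 2 ≤ (η * D) ^ 2 := pow_le_pow_left₀ hc hcD 2
      have h3 : D * 1 ≤ D * (2 * (η * D)) := by
        have h5 : η * (η * D * D) ≤ 1 * (η * D * D) := by gcongr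
        linarith
      exact le_of_mul_le_mul_left h3 hD
    · nlinarith
  have hD2k : D ^ (p + r + 3) ≤ 2 * η * D ^ (p + r + 4) := by
    have : D ^ (p + r + 3) * 1 ≤ D ^ (p + r + 3) * (2 * (η * D)) := by gcongr
    calc _ ≤ _ := by simpa using this
      _ = _ := by ring
  have e : N * ((D ^ (p + 2) / N + c ^ p * D) * (D ^ (r + 2) / N + c ^ r * D)) =
      D ^ (p + r + 4) / N + c ^ r * D ^ (p + 3) + c ^ p * D ^ (r + 3) +
        N * (c ^ (p + r) * D ^ 2) := by
    field_simp
    ring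
  have t1 : D ^ (p + r + 4) / N ≤ η * D ^ (p + r + 4) := by
    rw [div_le_iff₀ hN]
    calc _ = D ^ (p + r + 4) * 1 := by ring
      _ ≤ D ^ (p + r + 4) * (η * N) := by gcongr
      _ = _ := by ring
  have t2 : c ^ r * D ^ (p + 3) ≤ D ^ (p + r + 3) := by
    calc _ ≤ D ^ r * D ^ (p + 3) := by gcongr
      _ = _ := by ring
  have t3 : c ^ p * D ^ (r + 3) ≤ D ^ (p + r + 3) := by
    calc _ ≤ D ^ p * D ^ (r + 3) := by gcongr
      _ = _ := by ring
  have t4 : N * (c ^ (p + r) * D ^ 2) ≤ 4 * η * D ^ (p + r + 4) := by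
    rcases le_or_gt (2 * D) N with h | h
    · have h1 := hsq h
      calc N * (c ^ (p + r) * D ^ 2) = N * (c ^ (p + r) * D * D) := by ring
        _ ≤ N * (c ^ (p + r) * (2 * c ^ 2) * D) := by gcongr
        _ = 2 * D * (c ^ (p + r + 2) * N) := by ring
        _ ≤ 2 * D * (η * D ^ (p + r + 3)) := by gcongr
        _ = 2 * η * D ^ (p + r + 4) := by ring
        _ ≤ _ := by gcongr; norm_num
    · calc N * (c ^ (p + r) * D ^ 2) ≤ 2 * D * (D ^ (p + r) * D ^ 2) := by gcongr
        _ = 2 * D ^ (p + r + 3) := by ring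
        _ ≤ _ := by linarith
  rw [e]
  linarith

theorem IsNDLambdaGraph.opBound {V : Type*} [Fintype V] [DecidableEq V] [Nonempty V]
    {Γ : SimpleGraph V} [DecidableRel Γ.Adj] {n d : ℕ} {c : ℝ} (h : IsNDLambdaGraph Γ n d c)
    (hD : Γ.adjMatrix ℝ *ᵥ 1 = (d : ℝ) • 1) (hc : c < d) :
    OpBound (centered (Γ.adjMatrix ℝ) d) c := by
  have hreal : Γ.adjMatrix ℝ = realAdjMatrix Γ := by
    unfold realAdjMatrix; congr!
  have hA : (Γ.adjMatrix ℝ).IsHermitian := hreal ▸ realAdjMatrix_isHermitian Γ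
  have hpos : 0 < Fintype.card V := Fintype.card_pos
  refine opBound_centered hA hD hc
    -- `i₀` is the index of the largest eigenvalue; all others lie between `λₙ` and `λ₂`.
    (i₀ := Fintype.equivOfCardEq (Fintype.card_fin _) ⟨0, hpos⟩) fun i hi => ?_
  set l : Fin (Fintype.card V) := (Fintype.equivOfCardEq (Fintype.card_fin _)).symm i with hl
  have hl0 : l.val ≠ 0 := by
    intro h0
    apply hi
    rw [show (⟨0, hpos⟩ : Fin (Fintype.card V)) = l from Fin.ext h0.symm, hl,
      Equiv.apply_symm_apply]
  have hev : hA.eigenvalues i = graphEigenvalue Γ l := by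
    unfold graphEigenvalue Matrix.IsHermitian.eigenvalues
    rw [← hl]
    congr!
  have h2 : 2 ≤ Fintype.card V := by have := l.isLt; omega
  have hle := (le_abs_self _).trans h.abs_second_le
  rw [secondEigenvalue, dif_pos h2, max_le_iff] at hle
  rw [hev, abs_le]
  constructor
  · have := graphEigenvalue_antitone Γ
      (show l ≤ ⟨Fintype.card V - 1, by omega⟩ from Fin.mk_le_mk.2 (by have := l.isLt; omega))
    have := (abs_le.1 hle.2).1
    linarith
  · have := graphEigenvalue_antitone Γ
      (show (⟨1, by omega⟩ : Fin (Fintype.card V)) ≤ l from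
        Fin.mk_le_mk.2 (Nat.one_le_iff_ne_zero.2 hl0))
    linarith [hle.1]

theorem SimpleGraph.one_dotProduct_adjMatrix_mulVec_one {V : Type*} [Fintype V]
    (G : SimpleGraph V) [DecidableRel G.Adj] :
    (1 : V → ℝ) ⬝ᵥ (G.adjMatrix ℝ *ᵥ 1) = 2 * (G.edgeSet.ncard : ℝ) := by
  classical
  have h1 : ∀ v, (G.adjMatrix ℝ *ᵥ 1) v = G.degree v := fun v => by
    have := G.adjMatrix_mulVec_const_apply (α := ℝ) (a := 1) (v := v)
    rw [mul_one] at this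
    exact this
  rw [← G.coe_edgeFinset, Set.ncard_coe_finset]
  simp only [dotProduct, h1, Pi.one_apply, one_mul]
  exact_mod_cast G.sum_degrees_eq_twice_card_edges

/-! ### The lower bound: a large bipartite subgraph. -/

theorem SimpleGraph.exists_bicolored_le {V : Type*} [Fintype V] (Γ : SimpleGraph V) :
    ∃ (H : SimpleGraph V) (χ : V → Bool), H ≤ Γ ∧ (∀ u v, H.Adj u v → χ u ≠ χ v) ∧
      Γ.edgeSet.ncard ≤ 2 * H.edgeSet.ncard := by
  classical
  let s : Bool → ℝ := fun b => if b then 1 else -1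
  have hzero : ∀ u v, u ≠ v → ∑ χ : V → Bool, s (χ u) * s (χ v) = 0 := by
    intro u v huv
    -- Flipping the colour of `u` reverses the sign of each summand, so the average over colourings
    -- is zero.
    have hinv : Function.Involutive fun χ : V → Bool => Function.update χ u (!χ u) := by
      intro χ; ext w; by_cases h : w = u <;> simp [h, Function.update]
    have h := Equiv.sum_comp (hinv.toPerm _) fun χ : V → Bool => s (χ u) * s (χ v)
    have h' : ∀ χ : V → Bool, s (hinv.toPerm _ χ u) * s (hinv.toPerm _ χ v) =
        -(s (χ u) * s (χ v)) := by
      intro χ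
      simp only [Function.Involutive.coe_toPerm, Function.update_self,
        Function.update_of_ne huv.symm]
      cases χ u <;> cases χ v <;> simp [s]
    simp only [h', Finset.sum_neg_distrib] at h
    linarith
  have hsum : ∑ χ : V → Bool, ∑ u, ∑ v, Γ.adjMatrix ℝ u v * (s (χ u) * s (χ v)) ≤
      ∑ χ : V → Bool, (0 : ℝ) := by
    rw [Finset.sum_comm]
    simp only [Finset.sum_const_zero]
    refine (Finset.sum_eq_zero fun u _ => ?_).le
    rw [Finset.sum_comm]
    refine Finset.sum_eq_zero fun v _ => ?_
    rw [← Finset.mul_sum]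
    by_cases huv : u = v
    · simp [huv]
    · rw [hzero u v huv, mul_zero]
  obtain ⟨χ, -, hχ⟩ := Finset.exists_le_of_sum_le Finset.univ_nonempty hsum
  let H : SimpleGraph V :=
    { Adj := fun u v => Γ.Adj u v ∧ χ u ≠ χ v
      symm := ⟨fun u v h => ⟨h.1.symm, h.2.symm⟩⟩
      loopless := ⟨fun u h => h.2 rfl⟩ }
  refine ⟨H, χ, fun u v h => h.1, fun u v h => h.2, ?_⟩
  have hH := H.one_dotProduct_adjMatrix_mulVec_one
  have hΓ := Γ.one_dotProduct_adjMatrix_mulVec_one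
  have hent : ∀ u v, 2 * H.adjMatrix ℝ u v =
      Γ.adjMatrix ℝ u v - Γ.adjMatrix ℝ u v * (s (χ u) * s (χ v)) := by
    intro u v
    simp only [SimpleGraph.adjMatrix_apply, H]
    by_cases h : Γ.Adj u v
    · cases χ u <;> cases χ v <;> simp [s, h] <;> norm_num
    · simp [h]
  have hexp : ∀ X : Matrix V V ℝ, (1 : V → ℝ) ⬝ᵥ (X *ᵥ 1) = ∑ u, ∑ v, X u v := by
    intro X; simp [dotProduct, mulVec]
  rw [hexp] at hH hΓ
  have : 2 * ∑ u, ∑ v, H.adjMatrix ℝ u v = ∑ u, ∑ v, Γ.adjMatrix ℝ u v -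
      ∑ u, ∑ v, Γ.adjMatrix ℝ u v * (s (χ u) * s (χ v)) := by
    simp only [Finset.mul_sum, hent, Finset.sum_sub_distrib]
  have hR : (Γ.edgeSet.ncard : ℝ) ≤ 2 * H.edgeSet.ncard := by linarith
  exact_mod_cast hR

theorem SimpleGraph.cycleGraph_free_of_bicolored {V : Type*} {H : SimpleGraph V} {χ : V → Bool}
    (hχ : ∀ u v, H.Adj u v → χ u ≠ χ v) {m : ℕ} (hm : 2 ≤ m) (hodd : Odd m) :
    (cycleGraph m).Free H := by
  rintro ⟨f⟩
  have hc : H.Colorable 2 := (Coloring.mk χ fun {u v} h => hχ u v h).colorable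
  have h2 := (hc.of_hom f.toHom).chromaticNumber_le
  rw [chromaticNumber_cycleGraph_of_odd m hm hodd] at h2
  exact absurd h2 (by decide)

theorem half_edges_le_turanNumber {V : Type*} [Fintype V] (Γ : SimpleGraph V) {k : ℕ}
    (hk : 1 ≤ k) : Γ.edgeSet.ncard ≤
      2 * generalizedTuranNumber Γ (SimpleGraph.cycleGraph (2 * k + 1)) := by
  obtain ⟨H, χ, hH, hχ, he⟩ := Γ.exists_bicolored_le
  refine he.trans (Nat.mul_le_mul_left _ ?_)
  refine le_csSup ⟨Γ.edgeSet.ncard, ?_⟩ ⟨H, hH,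
    SimpleGraph.cycleGraph_free_of_bicolored hχ (by omega) ⟨k, rfl⟩, rfl⟩
  rintro m ⟨G, hG, -, rfl⟩
  exact Set.ncard_le_ncard (SimpleGraph.edgeSet_mono hG) (Set.toFinite _)

theorem exists_free_ncard_eq_turanNumber {V : Type*} [Fintype V] (Γ : SimpleGraph V) {k : ℕ}
    (hk : 1 ≤ k) : ∃ G ≤ Γ, (SimpleGraph.cycleGraph (2 * k + 1)).Free G ∧
      G.edgeSet.ncard = generalizedTuranNumber Γ (SimpleGraph.cycleGraph (2 * k + 1)) := by
  refine (isGreatest_generalizedTuranNumber Γ _ fun h => ?_).1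
  have h1 : (SimpleGraph.cycleGraph (2 * k + 1)).Adj ⟨0, by omega⟩ ⟨1, by omega⟩ :=
    SimpleGraph.cycleGraph_adj'.2 (Or.inr (by
      rw [Fin.sub_val_of_le (by simp)]
      rfl))
  rw [h] at h1
  exact h1

/-! ### The upper bound and the conclusion. -/

theorem IsNDLambdaGraph.adjMatrix_mulVec_one {V : Type*} [Fintype V] {Γ : SimpleGraph V}
    [DecidableRel Γ.Adj] {n d : ℕ} {c : ℝ} (h : IsNDLambdaGraph Γ n d c) :
    (∀ v, Γ.degree v = d) ∧ Γ.adjMatrix ℝ *ᵥ 1 = (d : ℝ) • 1 := by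
  have hdeg : ∀ v, Γ.degree v = d := fun v => by
    rw [← h.regular v, ← SimpleGraph.card_neighborFinset_eq_degree, ← Set.ncard_coe_finset,
      SimpleGraph.coe_neighborFinset]
  refine ⟨hdeg, ?_⟩
  ext v
  have := Γ.adjMatrix_mulVec_const_apply (α := ℝ) (a := 1) (v := v)
  rw [mul_one, hdeg] at this
  simpa using this

theorem IsNDLambdaGraph.ncard_edgeSet {V : Type*} [Fintype V] {Γ : SimpleGraph V}
    {n d : ℕ} {c : ℝ} (h : IsNDLambdaGraph Γ n d c) :
    2 * (Γ.edgeSet.ncard : ℝ) = d * n := by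
  classical
  rw [← Γ.one_dotProduct_adjMatrix_mulVec_one, h.adjMatrix_mulVec_one.2, ← h.card_eq]
  simp [dotProduct]
  ring

/-- In a sufficiently pseudorandom graph, a relative density above `1 / 2 + ε` of a
`C_{2k+1}`-free subgraph forces the pseudorandomness parameter `η` to be large. -/
theorem IsNDLambdaGraph.le_of_free {V : Type*} [Fintype V] {Γ G : SimpleGraph V} {n d : ℕ}
    {c η ε : ℝ} {k : ℕ} (hk : 1 ≤ k) (hd : 0 < d) (hn : 0 < n) (h : IsNDLambdaGraph Γ n d c)
    (hη : 0 < η) (hη1 : η < 1) (hηn : 1 ≤ η * n)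
    (hmain : c ^ (2 * k - 1) * n ≤ η ^ (2 * k - 1) * (d : ℝ) ^ (2 * k)) (hGΓ : G ≤ Γ)
    (hG : (SimpleGraph.cycleGraph (2 * k + 1)).Free G) (hε : 0 < ε)
    (he : (1 / 2 + ε) * (d * n) ≤ 2 * (G.edgeSet.ncard : ℝ)) :
    2 * ε * (1 / 2) ^ (2 * k - 1) ≤ η * (9 * (2 * k + 2) ^ 2 + 4) := by
  classical
  obtain ⟨j, rfl⟩ := Nat.exists_eq_add_of_le' hk
  rw [show 2 * (j + 1) - 1 = 2 * j + 1 by omega] at hmain ⊢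
  have hcard := h.card_eq
  have : Nonempty V := Fintype.card_pos_iff.1 (by omega)
  obtain ⟨hdeg, hA1⟩ := h.adjMatrix_mulVec_one
  have hc : 0 ≤ c := (abs_nonneg _).trans h.abs_second_le
  have hD : (0 : ℝ) < d := by exact_mod_cast hd
  have hN : (0 : ℝ) < n := by exact_mod_cast hn
  have hdn : d < n := by
    have v : V := Classical.arbitrary V
    rw [← hdeg v, ← hcard]
    exact Γ.degree_lt_card_verts v
  have hDN : (d : ℝ) ≤ n := by exact_mod_cast hdn.le
  have hcard' : (Fintype.card V : ℝ) = n := by rw [hcard]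
  -- One factor `d` of `hmain` is traded for `n`, then the odd root is taken.
  have hcη : c ≤ η * d := by
    refine le_of_pow_le_pow_left₀ (n := 2 * j + 1) (by omega) (by positivity) ?_
    have h1 : η ^ (2 * j + 1) * (d : ℝ) ^ (2 * (j + 1)) ≤ (η * d) ^ (2 * j + 1) * n := by
      calc _ = (η * d) ^ (2 * j + 1) * d := by ring
        _ ≤ _ := by gcongr
    exact le_of_mul_le_mul_right (hmain.trans h1) hN
  have hcd : c < d := hcη.trans_lt (by nlinarith)
  set A := Γ.adjMatrix ℝ
  set M := G.adjMatrix ℝ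
  have hAs : A.IsSymm := Γ.isSymm_adjMatrix
  have hMs : M.IsSymm := G.isSymm_adjMatrix
  have hE : OpBound (centered A d) c := h.opBound hA1 hcd
  have hMA : ∀ i j, 0 ≤ M i j ∧ M i j ≤ A i j := by
    intro i j
    simp only [A, M, SimpleGraph.adjMatrix_apply]
    by_cases hij : G.Adj i j
    · simp [hij, hGΓ hij]
    · simp only [hij, if_false, le_refl, true_and]
      split_ifs <;> norm_num
  have hAA : ∀ v, (A ^ 2) v v = d := fun v => by
    rw [sq, Γ.adjMatrix_mul_self_apply_self, hdeg]
  have hdiag : ∀ a, 2 ≤ a → ∀ v, (A ^ a) v v ≤ (d : ℝ) ^ a / n + c ^ (a - 2) * d := by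
    intro a ha v
    have := pow_diag_le hAs hA1 (hAA v) hc hE a ha
    rwa [hcard'] at this
  have hS : (A ^ (2 * (j + 1))).trace ≤ (d : ℝ) ^ (2 * (j + 1)) + c ^ (2 * j) * (n * d) := by
    calc _ ≤ ∑ v : V, ((d : ℝ) ^ (2 * (j + 1)) / n + c ^ (2 * j) * d) :=
        Finset.sum_le_sum fun v _ => hdiag _ (by omega) v
      _ = n * ((d : ℝ) ^ (2 * (j + 1)) / n + c ^ (2 * j) * d) := by
        rw [Finset.sum_const, Finset.card_univ, hcard, nsmul_eq_mul]
      _ = _ := by field_simp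
  have hpowη : η ^ (2 * j + 1) ≤ η := pow_le_of_le_one hη.le hη1.le (by omega)
  have hcS : c * ((d : ℝ) ^ (2 * (j + 1)) + c ^ (2 * j) * (n * d)) ≤
      2 * η * (d : ℝ) ^ (2 * j + 3) := by
    have h1 : c * (d : ℝ) ^ (2 * (j + 1)) ≤ η * (d : ℝ) ^ (2 * j + 3) := by
      calc _ ≤ (η * d) * (d : ℝ) ^ (2 * (j + 1)) := by gcongr
        _ = _ := by ring
    have h2 : c * (c ^ (2 * j) * (n * d)) ≤ η * (d : ℝ) ^ (2 * j + 3) := by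
      calc _ = c ^ (2 * j + 1) * n * d := by ring
        _ ≤ η ^ (2 * j + 1) * (d : ℝ) ^ (2 * (j + 1)) * d := by gcongr
        _ ≤ η * (d : ℝ) ^ (2 * (j + 1)) * d := by gcongr
        _ = _ := by ring
    linarith
  have htr : (M ^ (2 * (j + 1) + 1)).trace ≤
      (2 * (j + 1 : ℕ) + 2) ^ 2 * (9 * η * (d : ℝ) ^ (2 * j + 3)) := by
    have := G.trace_pow_le_of_free (m := 2 * (j + 1) + 1) (by omega) hG
      (q := 9 * η * (d : ℝ) ^ (2 * j + 3)) (by positivity) ?_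
    · convert this using 3
      push_cast
      ring
    · intro a b ha hb hab
      obtain ⟨p, rfl⟩ := Nat.exists_eq_add_of_le' ha
      obtain ⟨r, rfl⟩ := Nat.exists_eq_add_of_le' hb
      have hpr : p + r + 1 = 2 * j := by omega
      have hq := degenerate_bound (p := p) (r := r) hD hDN hc hη hη1.le hcη hηn (fun h2 => ?_) ?_
      · rw [show p + r + 4 = 2 * j + 3 by omega] at hq
        refine le_trans ?_ hq
        calc _ ≤ ∑ w : V, ((d : ℝ) ^ (p + 2) / n + c ^ p * d) *
              ((d : ℝ) ^ (r + 2) / n + c ^ r * d) := by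
              refine Finset.sum_le_sum fun w _ => ?_
              have hp := hdiag (p + 2) ha w
              have hr := hdiag (r + 2) hb w
              exact mul_le_mul ((pow_apply_nonneg_le hMA _ w w).2.trans hp)
                ((pow_apply_nonneg_le hMA _ w w).2.trans hr)
                (pow_apply_nonneg_le hMA _ w w).1 (by positivity)
          _ = _ := by rw [Finset.sum_const, Finset.card_univ, hcard, nsmul_eq_mul]
      · have h3 := le_opBound_sq hAs hA1 (hAA (Classical.arbitrary V)) hE
        rw [hcard'] at h3
        have h4 : (d : ℝ) ^ 2 / n ≤ d / 2 := by
          rw [div_le_iff₀ hN]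
          nlinarith
        linarith
      · rw [show p + r + 2 = 2 * j + 1 by omega, show p + r + 3 = 2 * (j + 1) by omega]
        exact hmain.trans (by gcongr)
  have hdef := walk_deficit_le hMs hMA hAs hA1 hc hE (Nat.le_add_left 1 j) hS
  have ht : (0 : ℝ) < (1 / 2 + ε) * d := by positivity
  have hW1 : (1 / 2 + ε) * d * Fintype.card V ≤ 1 ⬝ᵥ (M *ᵥ 1) := by
    rw [G.one_dotProduct_adjMatrix_mulVec_one, hcard']
    linarith
  have hMh : M.IsHermitian := by simpa [Matrix.IsHermitian, Matrix.IsSymm] using hMs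
  obtain ⟨hw1, hw2⟩ := walk_moment_bounds hMh ht.le hW1 (Nat.le_add_left 1 j)
  rw [show 2 * (j + 1) - 1 = 2 * j + 1 by omega] at hw1 hdef
  rw [hcard'] at hw2 hdef
  set W := (1 : V → ℝ) ⬝ᵥ ((M ^ (2 * (j + 1))) *ᵥ 1)
  set W' := (1 : V → ℝ) ⬝ᵥ ((M ^ (2 * j + 1)) *ᵥ 1)
  set t := (1 / 2 + ε) * (d : ℝ) with htdef
  -- After multiplication by `t`, the identity `2 * t - d = 2 * ε * d` extracts the gain over
  -- density one half.
  have hlow : 2 * ε * d * (t ^ (2 * j + 1) * n) ≤ 2 * W - d * W' := by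
    refine le_of_mul_le_mul_left ?_ ht
    calc t * (2 * ε * d * (t ^ (2 * j + 1) * n)) = 2 * ε * d * (t ^ (2 * (j + 1)) * n) := by ring
      _ ≤ 2 * ε * d * W := by gcongr
      _ = 2 * t * W - d * W := by rw [htdef]; ring
      _ ≤ 2 * t * W - d * (t * W') := by gcongr
      _ = _ := by ring
  have hlow' : 2 * ε * (1 / 2) ^ (2 * j + 1) * (d : ℝ) ^ (2 * j + 3) ≤
      d / n * (2 * W - d * W') := by
    calc _ = 2 * ε * d * ((1 / 2 * d) ^ (2 * j + 1) * d) := by ring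
      _ ≤ 2 * ε * d * (t ^ (2 * j + 1) * d) := by
        gcongr
        rw [htdef]
        gcongr
        linarith
      _ = d / n * (2 * ε * d * (t ^ (2 * j + 1) * n)) := by field_simp
      _ ≤ _ := by gcongr
  have hfin : 2 * ε * (1 / 2) ^ (2 * j + 1) * (d : ℝ) ^ (2 * j + 3) ≤
      η * (9 * (2 * (j + 1 : ℕ) + 2) ^ 2 + 4) * (d : ℝ) ^ (2 * j + 3) := by
    linarith
  exact le_of_mul_le_mul_right hfin (by positivity)

theorem mainTheorem2 (k : ℕ) (hk : 1 ≤ k)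
    (n d : ℕ → ℕ) (lam : ℕ → ℝ)
    (hn : Tendsto n atTop atTop)
    (hd : ∀ i, 0 < d i)
    (hlam : Tendsto
      (fun i => lam i ^ (2 * k - 1) /
        ((d i : ℝ) ^ (2 * k) / (n i : ℝ) *
          Real.log (n i : ℝ) ^ (-(2 * ((k : ℤ) - 1) * (2 * (k : ℤ) - 1)))))
      atTop (𝓝 0)) :
    ∀ ε : ℝ, 0 < ε → ∀ᶠ i in atTop,
      ∀ (V : Type u) [Fintype V] (Γ : SimpleGraph V),
        IsNDLambdaGraph Γ (n i) (d i) (lam i) →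
          |(generalizedTuranNumber Γ (SimpleGraph.cycleGraph (2 * k + 1)) : ℝ) -
              1 / 2 * ((d i : ℝ) * (n i : ℝ) / 2)| ≤
            ε * ((d i : ℝ) * (n i : ℝ) / 2) := by
  intro ε hε
  set K : ℝ := 9 * (2 * k + 2) ^ 2 + 4 with hK
  have hKpos : 0 < K := by positivity
  -- Small enough to violate the conclusion of `IsNDLambdaGraph.le_of_free`. In `K`, `(2k+2)^2`
  -- bounds the number of repeat positions and `4` comes from the two trace errors.
  obtain ⟨η, hη, hη'⟩ : ∃ η : ℝ, 0 < η ∧ η < min 1 (2 * ε * (1 / 2) ^ (2 * k - 1) / K) :=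
    exists_between (by positivity)
  rw [lt_min_iff, lt_div_iff₀ hKpos] at hη'
  have hnR : Tendsto (fun i => (n i : ℝ)) atTop atTop := tendsto_natCast_atTop_atTop.comp hn
  filter_upwards [hlam.eventually (gt_mem_nhds (show 0 < η ^ (2 * k - 1) by positivity)),
    hnR.eventually_ge_atTop (1 / η), hnR.eventually_ge_atTop (Real.exp 1)]
    with i hi1 hi2 hi3 V _ Γ hΓ
  have hnpos : (0 : ℝ) < n i := (Real.exp_pos 1).trans_le hi3
  have hlog : 1 ≤ Real.log (n i) := by rwa [Real.le_log_iff_exp_le hnpos]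
  have hD : (0 : ℝ) < d i := by exact_mod_cast hd i
  -- The exponent is nonpositive and `n i ≥ e`, so the logarithmic factor can be dropped.
  have hlogle : Real.log (n i : ℝ) ^ (-(2 * ((k : ℤ) - 1) * (2 * (k : ℤ) - 1))) ≤ 1 := by
    apply zpow_le_one_of_nonpos₀ hlog
    have h1 : (0 : ℤ) ≤ (k : ℤ) - 1 := by omega
    have h2 : (0 : ℤ) ≤ 2 * (k : ℤ) - 1 := by omega
    have := mul_nonneg h1 h2
    linarith
  have hlogpos : 0 < Real.log (n i : ℝ) ^ (-(2 * ((k : ℤ) - 1) * (2 * (k : ℤ) - 1))) :=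
    zpow_pos (by linarith) _
  have hmain : lam i ^ (2 * k - 1) * n i ≤ η ^ (2 * k - 1) * (d i : ℝ) ^ (2 * k) := by
    rw [div_lt_iff₀ (by positivity)] at hi1
    have h2 : lam i ^ (2 * k - 1) ≤ η ^ (2 * k - 1) * ((d i : ℝ) ^ (2 * k) / n i) := by
      refine hi1.le.trans ?_
      gcongr
      exact mul_le_of_le_one_right (by positivity) hlogle
    rw [← mul_div_assoc, le_div_iff₀ hnpos] at h2
    exact h2
  have he := hΓ.ncard_edgeSet
  have hlow : (Γ.edgeSet.ncard : ℝ) ≤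
      2 * generalizedTuranNumber Γ (SimpleGraph.cycleGraph (2 * k + 1)) := by
    exact_mod_cast half_edges_le_turanNumber Γ hk
  have hpos : 0 < ε * ((d i : ℝ) * n i / 2) := by positivity
  rw [abs_le]
  refine ⟨by linarith, ?_⟩
  by_contra! hcon
  obtain ⟨G, hGΓ, hG, hGe⟩ := exists_free_ncard_eq_turanNumber Γ hk
  rw [← hGe] at hcon
  have hηn : 1 ≤ η * n i := by
    rw [div_le_iff₀ hη] at hi2
    linarith
  have := hΓ.le_of_free hk (hd i) (by exact_mod_cast hnpos) hη hη'.1 hηn hmain hGΓ hG hε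
    (by linarith)
  linarith
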